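/- Let $(\Omega,\Sigma)$ be a standard Borel space. A game is a set function $\nu:\Sigma\to\mathbb R$ with $\nu(\emptyset)=0$; it is monotone if $\nu(S)\le\nu(T)$ whenever $S\subseteq T$. For games write $\nu\preceq\nu'$ if $\nu'-\nu$ is monotone, and $\nu\le\nu'$ if $\nu(S)\le\nu'(S)$ for all $S\in\Sigma$. Let $BV$ be the space of games of bounded variation (i.e. $\sup\sum_i|\nu(S_{i+1})-\nu(S_i)|<\infty$ over finite chains $S_0\subseteq\dots\subseteq S_n$ in $\Sigma$), $NA$ the space of nonatomic countably additive finite signed measures on $\Sigma$, and $NA^+$ its cone of nonnegative elements. Let $AC_\infty$ be the space of Lipschitz games, i.e. of those $\nu\in BV$ for which there is $\mu\in NA^+$ with $-\mu\preceq\nu\preceq\mu$, with the norm $$\|\nu\|_\infty=\inf\{\mu(\Omega):\mu\in NA^+,\ -\mu\preceq\nu\preceq\mu\}.$$ For $\mu\in NA^+$ and a finite partition $D$ of $E\in\Sigma$ into sets of $\Sigma$ let $\delta_\mu(D)=\max_{I\in D}\mu(I)$. A game $\nu$ is Burkill-Cesari integrable, $\nu\in BC$, if for some $\mu\in NA^+$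 the limit $$\partial^+_\emptyset(\nu,E)=\lim_{\delta_\mu(D)\to0}\ \sum_{I\in D}\nu(I)$$ over the finite partitions $D$ of $E$ exists in $\mathbb R$ for every $E\in\Sigma$ (it does not depend on the choice of $\mu$). Let $Q=BC\cap AC_\infty$, and let $Y$ be the $\|\cdot\|_\infty$-closure of $Q$ in $AC_\infty$. For a linear space $V$ with $NA\subseteq V\subseteq AC_\infty$, a linear map $\psi:V\to NA$ is a Milnor operator if for every $\nu\in V$ one has $\nu_*\le\psi\nu\le\nu^*$, where $\nu^*$ is the greatest lower bound of $\{\lambda\in NA:\nu\preceq\lambda\}$ in $(NA,\le)$ and $\nu_*$ is the least upper bound of $\{\lambda\in NA:\lambda\preceq\nu\}$ in $(NA,\le)$ (both exist). For an automorphism $\vartheta$ of $(\Omega,\Sigma)$ put $(\vartheta_*\nu)(S)=\nu(\vartheta(S))$. A linear map $\varphi:V\to NA$ on a linear space $V\subseteq BV$ with $\vartheta_*V\subseteq V$ for all automorphisms $\vartheta$ is a semivalue if $\varphi(\vartheta_*\nu)=\vartheta_*\varphi(\nu)$ for all $\vartheta$ and all $\nu\in V$, $\varphi(\nu)\ge0$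 for every monotone $\nu\in V$, and $\varphi(\nu)=\nu$ for every $\nu\in NA\cap V$. A Milnor semivalue on $V$ is a Milnor operator on $V$ that is a semivalue. **Theorem.** There is a $\|\cdot\|_\infty$-continuous linear Milnor operator $\widetilde\partial:AC_\infty\to NA$ with $\widetilde\partial(\nu)=\partial^+_\emptyset(\nu,\cdot)$ for all $\nu\in Q$; and for every such $\widetilde\partial$, the space $Y$ satisfies $NA\subseteq Y$, $Y\subseteq AC_\infty\subseteq BV$ and $\vartheta_*Y\subseteq Y$ for all automorphisms $\vartheta$, and the restriction of $\widetilde\partial$ to $Y$ is a Milnor semivalue on $Y$. -/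

import Mathlib

open MeasureTheory Filter Topology

noncomputable section

namespace TUGame

/-- The coalitions: the measurable subsets of `Ω`, with their Boolean algebra structure
(`⊥ = ∅`, `⊤ = Ω`, `≤` is inclusion). -/
abbrev Coalition (Ω : Type*) [MeasurableSpace Ω] : Type _ :=
  Subtype (MeasurableSet : Set Ω → Prop)

/-- The set functions on the measurable sets that vanish at the empty set. -/
def gameSubmodule (Ω : Type*) [MeasurableSpace Ω] : Submodule ℝ (Coalition Ω → ℝ) where
  carrier := {ν | ν ⊥ = 0}
  add_mem' := by
    intro a b ha hb
    simp only [Set.mem_ofPred_eq, Pi.add_apply] at *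
    rw [ha, hb, add_zero]
  zero_mem' := rfl
  smul_mem' := by
    intro c a ha
    simp only [Set.mem_ofPred_eq, Pi.smul_apply, smul_eq_mul] at *
    rw [ha, mul_zero]

/-- A (TU) game on `(Ω, Σ)`: a set function `ν : Σ → ℝ` with `ν ∅ = 0`. -/
def Game (Ω : Type*) [MeasurableSpace Ω] : Type _ := gameSubmodule Ω

section Basic

variable {Ω : Type*} [MeasurableSpace Ω]

instance : AddCommGroup (Game Ω) := inferInstanceAs (AddCommGroup (gameSubmodule Ω))

instance : Module ℝ (Game Ω) := inferInstanceAs (Module ℝ (gameSubmodule Ω))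

/-- The setwise order: `ν ≤ ν'` iff `ν S ≤ ν' S` for all coalitions `S`. -/
instance : PartialOrder (Game Ω) := inferInstanceAs (PartialOrder (gameSubmodule Ω))

instance : FunLike (Game Ω) (Coalition Ω) ℝ where
  coe ν := ν.1
  coe_injective := Subtype.coe_injective

/-- The game with a given underlying set function. -/
def Game.mk (f : Coalition Ω → ℝ) (hf : f ⊥ = 0) : Game Ω := ⟨f, hf⟩

@[simp] theorem Game.mk_apply (f : Coalition Ω → ℝ) (hf : f ⊥ = 0) (S : Coalition Ω) :
    Game.mk f hf S = f S := rfl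

@[ext] theorem Game.ext {ν ν' : Game Ω} (h : ∀ S, ν S = ν' S) : ν = ν' := DFunLike.ext _ _ h

@[simp] theorem Game.bot_apply (ν : Game Ω) : ν ⊥ = 0 := ν.2

@[simp] theorem Game.zero_apply (S : Coalition Ω) : (0 : Game Ω) S = 0 := rfl

@[simp] theorem Game.add_apply (ν ν' : Game Ω) (S : Coalition Ω) :
    (ν + ν') S = ν S + ν' S := rfl

@[simp] theorem Game.neg_apply (ν : Game Ω) (S : Coalition Ω) : (-ν) S = -ν S := rfl

@[simp] theorem Game.sub_apply (ν ν' : Game Ω) (S : Coalition Ω) :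
    (ν - ν') S = ν S - ν' S := rfl

@[simp] theorem Game.smul_apply (c : ℝ) (ν : Game Ω) (S : Coalition Ω) :
    (c • ν) S = c * ν S := rfl

theorem Game.le_def {ν ν' : Game Ω} : ν ≤ ν' ↔ ∀ S, ν S ≤ ν' S := Iff.rfl

/-- The order `ν ⪯ ν'` induced by the cone of monotone games: `ν' - ν` is a monotone game. -/
def Game.Prec (ν ν' : Game Ω) : Prop := Monotone (ν' - ν : Game Ω)

/-- `ν` is of bounded variation: `∑ |ν(Sᵢ₊₁) - ν(Sᵢ)|` is bounded over all finite chains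
`S₀ ⊆ S₁ ⊆ ⋯ ⊆ Sₙ`. -/
def Game.IsBV (ν : Game Ω) : Prop :=
  ∃ C : ℝ, ∀ (n : ℕ) (S : ℕ → Coalition Ω), Monotone S →
    ∑ i ∈ Finset.range n, |ν (S (i + 1)) - ν (S i)| ≤ C

/-- `ν` has no atoms, an atom being a coalition `S` with `ν S ≠ 0` such that `ν T ∈ {0, ν S}`
for all coalitions `T ⊆ S`. -/
def Game.IsNonatomic (ν : Game Ω) : Prop :=
  ∀ S : Coalition Ω, ν S ≠ 0 → ∃ T ≤ S, ν T ≠ 0 ∧ ν T ≠ ν S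

/-- `ν` is a countably additive (finite, signed) measure. -/
def Game.IsMeasure (ν : Game Ω) : Prop :=
  ∃ m : SignedMeasure Ω, ∀ S : Coalition Ω, ν S = m (S : Set Ω)

/-- The image `θ(S)` of a coalition under an automorphism `θ` of `(Ω, Σ)`. -/
def imageCoalition (θ : Ω ≃ᵐ Ω) (S : Coalition Ω) : Coalition Ω :=
  ⟨θ '' (S : Set Ω), θ.measurableSet_image.2 S.2⟩

/-- The linear map `θ_*` induced on games by an automorphism `θ`: `(θ_* ν)(S) = ν(θ(S))`. -/
def pullback (θ : Ω ≃ᵐ Ω) : Game Ω →ₗ[ℝ] Game Ω where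
  toFun ν := Game.mk (fun S => ν (imageCoalition θ S)) (by
    have : imageCoalition θ (⊥ : Coalition Ω) = ⊥ := Subtype.ext (Set.image_empty _)
    rw [this, Game.bot_apply])
  map_add' _ _ := rfl
  map_smul' _ _ := rfl

/-- The space `BV` of games of bounded variation. -/
def BV (Ω : Type*) [MeasurableSpace Ω] : Submodule ℝ (Game Ω) where
  carrier := {ν | ν.IsBV}
  add_mem' := by
    rintro a b ⟨C, hC⟩ ⟨D, hD⟩
    refine ⟨C + D, fun n S hS => ?_⟩
    refine le_trans ?_ (add_le_add (hC n S hS) (hD n S hS))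
    rw [← Finset.sum_add_distrib]
    refine Finset.sum_le_sum fun i _ => ?_
    have : (a + b) (S (i + 1)) - (a + b) (S i)
        = (a (S (i + 1)) - a (S i)) + (b (S (i + 1)) - b (S i)) := by
      simp only [Game.add_apply]; ring
    rw [this]
    exact abs_add_le _ _
  zero_mem' := ⟨0, fun n S _ => by simp⟩
  smul_mem' := by
    rintro c a ⟨C, hC⟩
    refine ⟨|c| * C, fun n S hS => ?_⟩
    refine le_trans (le_of_eq ?_) (mul_le_mul_of_nonneg_left (hC n S hS) (abs_nonneg c))
    rw [Finset.mul_sum]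
    refine Finset.sum_congr rfl fun i _ => ?_
    rw [← abs_mul, Game.smul_apply, Game.smul_apply, mul_sub]

end Basic

section Nonatomic

variable {Ω : Type*} [MeasurableSpace Ω] [StandardBorelSpace Ω]

/-- The coalition with the single player `x`. -/
def single (x : Ω) : Coalition Ω := ⟨{x}, measurableSet_singleton x⟩

theorem Game.IsNonatomic.single_eq_zero {ν : Game Ω} (h : ν.IsNonatomic) (x : Ω) :
    ν (single x) = 0 := by
  by_contra h0
  obtain ⟨T, hT, h1, h2⟩ := h _ h0
  have hT' : (T : Set Ω) ⊆ {x} := hT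
  rcases Set.subset_singleton_iff_eq.1 hT' with h3 | h3
  · have : T = ⊥ := Subtype.ext h3
    rw [this] at h1
    exact h1 ν.bot_apply
  · have : T = single x := Subtype.ext h3
    rw [this] at h2
    exact h2 rfl

/-- On a standard Borel space a measure that vanishes on the one-point sets has no atoms. -/
theorem Game.IsMeasure.isNonatomic {ν : Game Ω} (hm : ν.IsMeasure)
    (h : ∀ x, ν (single x) = 0) : ν.IsNonatomic := by
  obtain ⟨m, hm⟩ := hm
  intro S hS
  by_contra hcon
  push Not at hcon
  have hat : ∀ T : Set Ω, MeasurableSet T → T ⊆ S → m T ≠ 0 → m T = m S := by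
    intro T hT hTS h0
    have := hcon ⟨T, hT⟩ hTS (by rw [hm]; exact h0)
    rwa [hm, hm] at this
  have hS' : m S ≠ 0 := by rw [← hm]; exact hS
  let A : ℕ → Set Ω := MeasurableSpace.natGeneratingSequence Ω
  have hA : ∀ n, MeasurableSet (A n) := MeasurableSpace.measurableSet_natGeneratingSequence
  -- inside any atom one of the two halves is an atom
  have step : ∀ (T : Set Ω) (n : ℕ), MeasurableSet T → T ⊆ S → m T = m S →
      m (T ∩ A n) = m S ∨ m (T ∩ (A n)ᶜ) = m S := by
    intro T n hT hTS hTm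
    by_contra hne
    push Not at hne
    have e1 : m (T ∩ A n) = 0 := by
      by_contra h0
      exact hne.1 (hat _ (hT.inter (hA n)) (Set.inter_subset_left.trans hTS) h0)
    have e2 : m (T ∩ (A n)ᶜ) = 0 := by
      by_contra h0
      exact hne.2 (hat _ (hT.inter (hA n).compl) (Set.inter_subset_left.trans hTS) h0)
    have e3 : m T = m (T ∩ A n) + m (T ∩ (A n)ᶜ) := by
      rw [← VectorMeasure.of_union _ (hT.inter (hA n)) (hT.inter (hA n).compl),
        Set.inter_union_compl]
      exact (disjoint_compl_right.inf_left' _).inf_right' _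
    rw [e1, e2, add_zero, hTm] at e3
    exact hS' e3
  classical
  let B : ℕ → Set Ω := fun n => Nat.rec (S : Set Ω)
    (fun k T => if m (T ∩ A k) = m S then T ∩ A k else T ∩ (A k)ᶜ) n
  have hBs : ∀ n, B (n + 1) = if m (B n ∩ A n) = m S then B n ∩ A n else B n ∩ (A n)ᶜ :=
    fun n => rfl
  have hB : ∀ n, MeasurableSet (B n) ∧ B n ⊆ S ∧ m (B n) = m S := by
    intro n
    induction n with
    | zero => exact ⟨S.2, subset_rfl, rfl⟩
    | succ n ih =>
      obtain ⟨i1, i2, i3⟩ := ih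
      rw [hBs]
      split_ifs with hc
      · exact ⟨i1.inter (hA n), Set.inter_subset_left.trans i2, hc⟩
      · exact ⟨i1.inter (hA n).compl, Set.inter_subset_left.trans i2,
          (step _ n i1 i2 i3).resolve_left hc⟩
  have hanti : Antitone B := by
    refine antitone_nat_of_succ_le fun n => ?_
    rw [hBs]
    split_ifs <;> exact Set.inter_subset_left
  have hlim := VectorMeasure.tendsto_vectorMeasure_iInter_atTop_nat (v := m) hanti
    (fun n => (hB n).1)
  have hval : m (⋂ n, B n) = m S := by
    refine tendsto_nhds_unique hlim ?_
    simp only [fun n => (hB n).2.2]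
    exact tendsto_const_nhds
  have hsub : (⋂ n, B n).Subsingleton := by
    intro x hx y hy
    apply MeasurableSpace.injective_mapNatBool Ω
    funext n
    have hx' := Set.mem_iInter.1 hx (n + 1)
    have hy' := Set.mem_iInter.1 hy (n + 1)
    rw [hBs] at hx' hy'
    have : (x ∈ A n ↔ y ∈ A n) := by
      split_ifs at hx' hy' with hc
      · exact ⟨fun _ => hy'.2, fun _ => hx'.2⟩
      · exact ⟨fun h1 => absurd h1 hx'.2, fun h1 => absurd h1 hy'.2⟩
    simpa [MeasurableSpace.mapNatBool] using this
  rcases hsub.eq_empty_or_singleton with h0 | ⟨x, hx⟩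
  · rw [h0, VectorMeasure.empty] at hval
    exact hS' hval.symm
  · rw [hx] at hval
    have := h x
    rw [hm] at this
    exact hS' (hval.symm.trans this)

/-- The space `NA` of nonatomic countably additive (finite, signed) measures. -/
def NA (Ω : Type*) [MeasurableSpace Ω] [StandardBorelSpace Ω] : Submodule ℝ (Game Ω) where
  carrier := {ν | ν.IsMeasure ∧ ν.IsNonatomic}
  add_mem' := by
    rintro a b ⟨⟨m, hm⟩, ha⟩ ⟨⟨m', hm'⟩, hb⟩
    have key : (a + b).IsMeasure := ⟨m + m', fun S => by simp [hm, hm']⟩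
    exact ⟨key, key.isNonatomic fun x => by
      rw [Game.add_apply, ha.single_eq_zero, hb.single_eq_zero, add_zero]⟩
  zero_mem' := ⟨⟨0, fun S => by simp⟩, fun S hS => absurd rfl hS⟩
  smul_mem' := by
    rintro c a ⟨⟨m, hm⟩, ha⟩
    have key : (c • a).IsMeasure := ⟨c • m, fun S => by simp [hm]⟩
    exact ⟨key, key.isNonatomic fun x => by
      rw [Game.smul_apply, ha.single_eq_zero, mul_zero]⟩

/-- The cone `NA⁺` of nonnegative elements of `NA`. -/
def NAplus (Ω : Type*) [MeasurableSpace Ω] [StandardBorelSpace Ω] : Set (Game Ω) :=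
  {μ | μ ∈ NA Ω ∧ 0 ≤ μ}

theorem NAplus.add {μ μ' : Game Ω} (h : μ ∈ NAplus Ω) (h' : μ' ∈ NAplus Ω) :
    μ + μ' ∈ NAplus Ω :=
  ⟨add_mem h.1 h'.1, fun S => add_nonneg (h.2 S) (h'.2 S)⟩

theorem NAplus.smul {μ : Game Ω} (h : μ ∈ NAplus Ω) {c : ℝ} (hc : 0 ≤ c) :
    c • μ ∈ NAplus Ω :=
  ⟨Submodule.smul_mem _ _ h.1, fun S => mul_nonneg hc (h.2 S)⟩

theorem NAplus.zero : (0 : Game Ω) ∈ NAplus Ω := ⟨zero_mem _, le_rfl⟩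

theorem NAplus.monotone {μ : Game Ω} (h : μ ∈ NAplus Ω) : Monotone μ := by
  intro S T hST
  obtain ⟨⟨⟨m, hm⟩, -⟩, h0⟩ := h
  have h1 := h0 (T \ S)
  change 0 ≤ μ (T \ S) at h1
  have h2 := VectorMeasure.of_add_of_sdiff (v := m) S.2 T.2 hST
  have h3 : μ (T \ S) = m ((T : Set Ω) \ S) := hm _
  rw [hm, hm]
  linarith

/-! ### Lipschitz games -/

/-- `-μ ⪯ ν ⪯ μ`, i.e. `ν + μ` and `μ - ν` are monotone. -/
def Game.Dominated (ν μ : Game Ω) : Prop := Game.Prec (-μ) ν ∧ Game.Prec ν μ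

theorem Game.dominated_iff {ν μ : Game Ω} : ν.Dominated μ ↔
    ∀ S T : Coalition Ω, S ≤ T → |ν T - ν S| ≤ μ T - μ S := by
  constructor
  · rintro ⟨h1, h2⟩ S T hST
    have h3 := h1 hST
    have h4 := h2 hST
    simp only [Game.sub_apply, Game.neg_apply] at h3 h4
    rw [abs_le]
    constructor <;> linarith
  · intro h
    constructor <;> intro S T hST <;> have h1 := abs_le.1 (h S T hST) <;>
      simp only [Game.sub_apply, Game.neg_apply] <;> linarith [h1.1, h1.2]

theorem Game.Dominated.add {ν ν' μ μ' : Game Ω} (h : ν.Dominated μ) (h' : ν'.Dominated μ') :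
    (ν + ν').Dominated (μ + μ') := by
  rw [Game.dominated_iff] at *
  intro S T hST
  have h1 := abs_le.1 (h S T hST)
  have h2 := abs_le.1 (h' S T hST)
  simp only [Game.add_apply]
  rw [abs_le]
  constructor <;> linarith [h1.1, h1.2, h2.1, h2.2]

theorem Game.Dominated.smul {ν μ : Game Ω} (h : ν.Dominated μ) (c : ℝ) :
    (c • ν).Dominated (|c| • μ) := by
  rw [Game.dominated_iff] at *
  intro S T hST
  simp only [Game.smul_apply]
  rw [← mul_sub, ← mul_sub, abs_mul]
  exact mul_le_mul_of_nonneg_left (h S T hST) (abs_nonneg c)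

/-- The space `AC_∞` of Lipschitz games: the games `ν` in `BV` for which there is `μ ∈ NA⁺` such
that `μ - ν` and `ν + μ` are monotone. -/
def lipGames (Ω : Type*) [MeasurableSpace Ω] [StandardBorelSpace Ω] :
    Submodule ℝ (Game Ω) where
  carrier := {ν | ν ∈ BV Ω ∧ ∃ μ ∈ NAplus Ω, ν.Dominated μ}
  add_mem' := by
    rintro a b ⟨ha, μ, hμ, h⟩ ⟨hb, μ', hμ', h'⟩
    exact ⟨add_mem ha hb, μ + μ', NAplus.add hμ hμ', h.add h'⟩
  zero_mem' := ⟨zero_mem _, 0, NAplus.zero, Game.dominated_iff.2 fun S T _ => by simp⟩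
  smul_mem' := by
    rintro c a ⟨ha, μ, hμ, h⟩
    exact ⟨Submodule.smul_mem _ _ ha, |c| • μ, NAplus.smul hμ (abs_nonneg c), h.smul c⟩

/-- The values `μ(Ω)` for `μ ∈ NA⁺` with `-μ ⪯ ν ⪯ μ`. -/
def boundSet (ν : Game Ω) : Set ℝ := {r | ∃ μ ∈ NAplus Ω, ν.Dominated μ ∧ r = μ ⊤}

/-- `‖ν‖_∞ = inf {μ(Ω) : μ ∈ NA⁺, -μ ⪯ ν ⪯ μ}`. -/
instance : Norm (lipGames Ω) := ⟨fun ν => sInf (boundSet (ν : Game Ω))⟩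

theorem norm_def (ν : lipGames Ω) : ‖ν‖ = sInf (boundSet (ν : Game Ω)) := rfl

theorem boundSet_nonempty (ν : lipGames Ω) : (boundSet (ν : Game Ω)).Nonempty := by
  obtain ⟨-, μ, hμ, h⟩ := ν.2
  exact ⟨_, μ, hμ, h, rfl⟩

theorem boundSet_nonneg (ν : Game Ω) {r : ℝ} (hr : r ∈ boundSet ν) : 0 ≤ r := by
  obtain ⟨μ, hμ, -, rfl⟩ := hr
  exact hμ.2 ⊤

theorem boundSet_bddBelow (ν : Game Ω) : BddBelow (boundSet ν) :=
  ⟨0, fun _ hr => boundSet_nonneg ν hr⟩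

theorem norm_le_of_dominated (ν : lipGames Ω) {μ : Game Ω} (hμ : μ ∈ NAplus Ω)
    (h : (ν : Game Ω).Dominated μ) : ‖ν‖ ≤ μ ⊤ :=
  csInf_le (boundSet_bddBelow _) ⟨μ, hμ, h, rfl⟩

theorem exists_dominated_lt (ν : lipGames Ω) {r : ℝ} (hr : ‖ν‖ < r) :
    ∃ μ ∈ NAplus Ω, (ν : Game Ω).Dominated μ ∧ μ ⊤ < r := by
  obtain ⟨_, ⟨μ, hμ, h, rfl⟩, h2⟩ := exists_lt_of_csInf_lt (boundSet_nonempty ν) hr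
  exact ⟨μ, hμ, h, h2⟩

theorem norm_nonneg' (ν : lipGames Ω) : 0 ≤ ‖ν‖ :=
  Real.sInf_nonneg fun _ hr => boundSet_nonneg _ hr

theorem abs_apply_le_norm (ν : lipGames Ω) (S : Coalition Ω) : |(ν : Game Ω) S| ≤ ‖ν‖ := by
  refine le_of_forall_gt_imp_ge_of_dense fun r hr => ?_
  obtain ⟨μ, hμ, h, h2⟩ := exists_dominated_lt ν hr
  have h3 := Game.dominated_iff.1 h ⊥ S bot_le
  have h4 : μ S ≤ μ ⊤ := (NAplus.monotone hμ) le_top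
  simp only [Game.bot_apply, sub_zero] at h3
  linarith

theorem norm_smul_le' (c : ℝ) (ν : lipGames Ω) : ‖c • ν‖ ≤ |c| * ‖ν‖ := by
  refine le_of_forall_pos_le_add fun ε hε => ?_
  have hc : 0 < |c| + 1 := by positivity
  obtain ⟨μ, hμ, h, h2⟩ := exists_dominated_lt ν
    (lt_add_of_pos_right ‖ν‖ (div_pos hε hc))
  have h3 := norm_le_of_dominated (c • ν) (NAplus.smul hμ (abs_nonneg c)) (h.smul c)
  rw [Game.smul_apply] at h3
  have h4 : |c| * (ε / (|c| + 1)) ≤ ε := by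
    rw [mul_div_assoc', div_le_iff₀ hc]
    nlinarith [abs_nonneg c]
  have h5 := mul_le_mul_of_nonneg_left h2.le (abs_nonneg c)
  linarith [mul_add |c| ‖ν‖ (ε / (|c| + 1))]

theorem lipGames_normCore : NormedSpace.Core ℝ (lipGames Ω) where
  norm_nonneg := norm_nonneg'
  norm_smul := by
    intro c ν
    rw [Real.norm_eq_abs]
    refine le_antisymm (norm_smul_le' c ν) ?_
    rcases eq_or_ne c 0 with rfl | hc
    · simpa using norm_nonneg' ((0 : ℝ) • ν)
    · have h1 := norm_smul_le' c⁻¹ (c • ν)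
      rw [smul_smul, inv_mul_cancel₀ hc, one_smul, abs_inv] at h1
      have hc' : 0 < |c| := abs_pos.2 hc
      calc |c| * ‖ν‖ ≤ |c| * (|c|⁻¹ * ‖c • ν‖) := mul_le_mul_of_nonneg_left h1 hc'.le
        _ = ‖c • ν‖ := by rw [← mul_assoc, mul_inv_cancel₀ hc'.ne', one_mul]
  norm_triangle := by
    intro ν ν'
    refine le_of_forall_pos_le_add fun ε hε => ?_
    obtain ⟨μ, hμ, h, h2⟩ := exists_dominated_lt ν (lt_add_of_pos_right ‖ν‖ (half_pos hε))
    obtain ⟨μ', hμ', h', h2'⟩ := exists_dominated_lt ν' (lt_add_of_pos_right ‖ν'‖ (half_pos hε))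
    have h3 := norm_le_of_dominated (ν + ν') (NAplus.add hμ hμ') (h.add h')
    rw [Game.add_apply] at h3
    linarith
  norm_eq_zero_iff := by
    intro ν
    constructor
    · intro h
      refine Subtype.ext (Game.ext fun S => ?_)
      have := abs_apply_le_norm ν S
      rw [h] at this
      exact abs_eq_zero.1 (le_antisymm this (abs_nonneg _))
    · rintro rfl
      have h := norm_smul_le' (0 : ℝ) (0 : lipGames Ω)
      rw [smul_zero, abs_zero, zero_mul] at h
      exact le_antisymm h (norm_nonneg' _)

/-- `AC_∞` as a normed space, with the norm `‖·‖_∞` above. -/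
instance : NormedAddCommGroup (lipGames Ω) := NormedAddCommGroup.ofCore lipGames_normCore

instance : NormedSpace ℝ (lipGames Ω) := NormedSpace.ofCore lipGames_normCore

theorem isBV_of_dominated {ν μ : Game Ω} (h : ν.Dominated μ) (hμ : Monotone μ) :
    ν ∈ BV Ω := by
  refine ⟨μ ⊤, fun n S hS => ?_⟩
  calc ∑ i ∈ Finset.range n, |ν (S (i + 1)) - ν (S i)|
      ≤ ∑ i ∈ Finset.range n, (μ (S (i + 1)) - μ (S i)) :=
        Finset.sum_le_sum fun i _ => Game.dominated_iff.1 h _ _ (hS (Nat.le_succ i))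
    _ = μ (S n) - μ (S 0) := Finset.sum_range_sub (fun i => μ (S i)) n
    _ ≤ μ ⊤ := by
      have h1 : μ (S n) ≤ μ ⊤ := hμ le_top
      have h2 : μ ⊥ ≤ μ (S 0) := hμ bot_le
      rw [Game.bot_apply] at h2
      linarith

/-- `NA ⊆ AC_∞`: a measure is dominated by its total variation. -/
theorem NA_le_lipGames : NA Ω ≤ lipGames Ω := by
  rintro ν ⟨⟨m, hm⟩, hν⟩
  obtain ⟨i, hi, hpos, hneg, -, -⟩ := m.toJordanDecomposition_spec
  let μ : Game Ω := Game.mk (fun S => m (i ∩ S) - m (iᶜ ∩ S)) (by simp)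
  have hμ_apply : ∀ S : Coalition Ω, μ S = m (i ∩ S) - m (iᶜ ∩ S) := fun _ => rfl
  have p1 : ∀ T : Set Ω, MeasurableSet T → 0 ≤ m (i ∩ T) := by
    intro T hT
    have := VectorMeasure.subset_le_of_restrict_le_restrict _ _ hi hpos
      (Set.inter_subset_left : i ∩ T ⊆ i)
    simpa using this
  have p2 : ∀ T : Set Ω, MeasurableSet T → m (iᶜ ∩ T) ≤ 0 := by
    intro T hT
    have := VectorMeasure.subset_le_of_restrict_le_restrict _ _ hi.compl hneg
      (Set.inter_subset_left : iᶜ ∩ T ⊆ iᶜ)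
    simpa using this
  have hmeas : μ.IsMeasure := by
    refine ⟨m.restrict i - m.restrict iᶜ, fun S => ?_⟩
    rw [hμ_apply, sub_apply, VectorMeasure.restrict_apply _ hi S.2,
      VectorMeasure.restrict_apply _ hi.compl S.2, Set.inter_comm, Set.inter_comm iᶜ]
  have hsing : ∀ (x : Ω) (j : Set Ω), m (j ∩ {x}) = 0 := by
    intro x j
    rcases Set.subset_singleton_iff_eq.1 (Set.inter_subset_right : j ∩ {x} ⊆ {x}) with h | h
    · rw [h, VectorMeasure.empty]
    · rw [h]
      have := hν.single_eq_zero x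
      rw [hm] at this
      exact this
  have hμ : μ ∈ NAplus Ω := by
    refine ⟨⟨hmeas, hmeas.isNonatomic fun x => ?_⟩, fun S => ?_⟩
    · rw [hμ_apply]
      change m (i ∩ {x}) - m (iᶜ ∩ {x}) = 0
      rw [hsing, hsing, sub_zero]
    · change 0 ≤ μ S
      rw [hμ_apply]
      linarith [p1 S S.2, p2 S S.2]
  have split : ∀ T : Set Ω, MeasurableSet T → m T = m (i ∩ T) + m (iᶜ ∩ T) := by
    intro T hT
    rw [← VectorMeasure.of_union _ (hi.inter hT) (hi.compl.inter hT), Set.inter_comm i,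
      Set.inter_comm iᶜ, Set.inter_union_compl]
    exact (disjoint_compl_right.inf_left _).inf_right _
  have hdom : ν.Dominated μ := by
    rw [Game.dominated_iff]
    intro S T hST
    have hd : MeasurableSet ((T : Set Ω) \ S) := T.2.diff S.2
    have e1 : ∀ j : Set Ω, MeasurableSet j →
        m (j ∩ T) = m (j ∩ S) + m (j ∩ ((T : Set Ω) \ S)) := by
      intro j hj
      rw [← VectorMeasure.of_union _ (hj.inter S.2) (hj.inter hd), ← Set.inter_union_distrib_left,
        Set.union_sdiff_cancel hST]
      exact (disjoint_sdiff_self_right.inf_left' _).inf_right' _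
    have q1 := p1 _ hd
    have q2 := p2 _ hd
    have e2 := e1 i hi
    have e3 := e1 iᶜ hi.compl
    rw [hm, hm, hμ_apply, hμ_apply, split _ T.2, split _ S.2, abs_le]
    constructor <;> linarith
  exact ⟨isBV_of_dominated hdom (NAplus.monotone hμ), μ, hμ, hdom⟩

/-! ### The Burkill-Cesari integral -/

/-- The mesh `δ_μ(D) = max {μ(I) : I ∈ D}` of a finite partition `D` of a coalition `E` into
coalitions (empty members, which are irrelevant as games vanish at `∅`, are left out). -/
def mesh (μ : Game Ω) {E : Coalition Ω} (D : Finpartition E) : ℝ := ⨆ I : D.parts, μ I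

theorem mesh_lt_iff (μ : Game Ω) {E : Coalition Ω} (D : Finpartition E) {δ : ℝ} (hδ : 0 < δ) :
    mesh μ D < δ ↔ ∀ I ∈ D.parts, μ I < δ := by
  have hfin : (Set.range fun I : D.parts => μ I).Finite := Set.finite_range _
  constructor
  · intro h I hI
    exact (le_ciSup hfin.bddAbove (⟨I, hI⟩ : D.parts)).trans_lt h
  · intro h
    rcases isEmpty_or_nonempty D.parts with he | hne
    · rw [mesh, Real.iSup_of_isEmpty]; exact hδ
    · obtain ⟨I, hI⟩ := exists_eq_ciSup_of_finite (f := fun I : D.parts => μ I)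
      rw [mesh, ← hI]
      exact h I I.2

/-- `L = lim_{δ_μ(D) → 0} ∑_{I ∈ D} ν(I)`, over the finite partitions `D` of `E`. -/
def IsBCLimit (μ ν : Game Ω) (E : Coalition Ω) (L : ℝ) : Prop :=
  ∀ ε > 0, ∃ δ > 0, ∀ D : Finpartition E, mesh μ D < δ → |∑ I ∈ D.parts, ν I - L| < ε

/-- The set function `m` is the Burkill-Cesari integral of the game `ν`, with respect to the mesh
`δ_μ` of some `μ ∈ NA⁺`. -/
def IsBCIntegral (ν : Game Ω) (m : Coalition Ω → ℝ) : Prop :=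
  ∃ μ ∈ NAplus Ω, ∀ E : Coalition Ω, IsBCLimit μ ν E (m E)

theorem IsBCLimit.of_le {μ μ' ν : Game Ω} {E : Coalition Ω} {L : ℝ} (h : IsBCLimit μ ν E L)
    (hle : μ ≤ μ') : IsBCLimit μ' ν E L := by
  intro ε hε
  obtain ⟨δ, hδ, hD⟩ := h ε hε
  refine ⟨δ, hδ, fun D hm => hD D ?_⟩
  rw [mesh_lt_iff _ _ hδ] at *
  exact fun I hI => (hle I).trans_lt (hm I hI)

/-- The space `BC` of Burkill-Cesari integrable games: the games that are Burkill-Cesari integrable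
with respect to the mesh `δ_μ` of some `μ ∈ NA⁺`. -/
def BC (Ω : Type*) [MeasurableSpace Ω] [StandardBorelSpace Ω] : Submodule ℝ (Game Ω) where
  carrier := {ν | ∃ m : Coalition Ω → ℝ, IsBCIntegral ν m}
  add_mem' := by
    rintro a b ⟨m, μ, hμ, h⟩ ⟨m', μ', hμ', h'⟩
    refine ⟨m + m', μ + μ', NAplus.add hμ hμ', fun E ε hε => ?_⟩
    obtain ⟨δ, hδ, hD⟩ := IsBCLimit.of_le (μ' := μ + μ') (h E)
      (Game.le_def.2 fun S => le_add_of_nonneg_right (hμ'.2 S)) (ε / 2) (half_pos hε)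
    obtain ⟨δ', hδ', hD'⟩ := IsBCLimit.of_le (μ' := μ + μ') (h' E)
      (Game.le_def.2 fun S => le_add_of_nonneg_left (hμ.2 S)) (ε / 2) (half_pos hε)
    refine ⟨min δ δ', lt_min hδ hδ', fun D hm => ?_⟩
    have h1 := abs_lt.1 (hD D (hm.trans_le (min_le_left _ _)))
    have h2 := abs_lt.1 (hD' D (hm.trans_le (min_le_right _ _)))
    simp only [Game.add_apply, Pi.add_apply, Finset.sum_add_distrib]
    rw [abs_lt]
    constructor <;> linarith [h1.1, h1.2, h2.1, h2.2]
  zero_mem' := ⟨0, 0, NAplus.zero, fun E ε hε => ⟨1, one_pos, fun D _ => by simpa using hε⟩⟩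
  smul_mem' := by
    rintro c a ⟨m, μ, hμ, h⟩
    refine ⟨c • m, μ, hμ, fun E ε hε => ?_⟩
    have hc : 0 < |c| + 1 := by positivity
    obtain ⟨δ, hδ, hD⟩ := h E (ε / (|c| + 1)) (div_pos hε hc)
    refine ⟨δ, hδ, fun D hm => ?_⟩
    have h1 := hD D hm
    simp only [Game.smul_apply, Pi.smul_apply, smul_eq_mul]
    rw [← Finset.mul_sum, ← mul_sub, abs_mul]
    rw [lt_div_iff₀ hc] at h1
    nlinarith [abs_nonneg (∑ I ∈ D.parts, a I - m E)]

/-- The space `Q = BC ∩ AC_∞`. -/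
def Q (Ω : Type*) [MeasurableSpace Ω] [StandardBorelSpace Ω] : Submodule ℝ (Game Ω) :=
  BC Ω ⊓ lipGames Ω

/-- The space `Y`: the `‖·‖_∞`-closure of `Q` in `AC_∞`. -/
def Y (Ω : Type*) [MeasurableSpace Ω] [StandardBorelSpace Ω] : Submodule ℝ (Game Ω) :=
  ((Q Ω).comap (lipGames Ω).subtype).topologicalClosure.map (lipGames Ω).subtype

theorem Y_le_lipGames : Y Ω ≤ lipGames Ω := Submodule.map_subtype_le _ _

/-! ### Milnor operators and semivalues -/

/-- `D^ν`, the set of `lam ∈ NA` with `ν ⪯ lam`. -/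
def upperMeasures (ν : Game Ω) : Set (NA Ω) := {lam | Game.Prec ν lam}

/-- `D_ν`, the set of `lam ∈ NA` with `lam ⪯ ν`. -/
def lowerMeasures (ν : Game Ω) : Set (NA Ω) := {lam | Game.Prec lam ν}

/-- A linear operator `ψ : V → NA` on a linear subspace `NA ⊆ V ⊆ AC_∞` is a Milnor operator if
`ν_* ≤ ψ ν ≤ ν^*` for all `ν ∈ V`, where `ν^* = g.l.b. D^ν` and `ν_* = l.u.b. D_ν` exist in `NA`
with its setwise order. -/
structure IsMilnorOperator (V : Submodule ℝ (Game Ω)) (ψ : V →ₗ[ℝ] NA Ω) : Prop where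
  NA_le : NA Ω ≤ V
  le_lipGames : V ≤ lipGames Ω
  bounds : ∀ ν : V, ∃ lo hi : NA Ω, IsLUB (lowerMeasures (ν : Game Ω)) lo ∧
    IsGLB (upperMeasures (ν : Game Ω)) hi ∧ lo ≤ ψ ν ∧ ψ ν ≤ hi

/-- A space of games is symmetric if it is invariant under `θ_*` for all automorphisms `θ`. -/
def IsSymmetricSpace (V : Submodule ℝ (Game Ω)) : Prop :=
  ∀ θ : Ω ≃ᵐ Ω, ∀ ν ∈ V, pullback θ ν ∈ V

/-- A linear map `φ : V → NA` on a symmetric subspace `V` of `BV` is a semivalue if it is symmetric,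
positive, and the identity on `NA ∩ V`. -/
structure IsSemivalue (V : Submodule ℝ (Game Ω)) (φ : V →ₗ[ℝ] NA Ω) : Prop where
  le_BV : V ≤ BV Ω
  symmetricSpace : IsSymmetricSpace V
  symmetry : ∀ (θ : Ω ≃ᵐ Ω) (ν : V),
    (φ ⟨pullback θ ν, symmetricSpace θ ν ν.2⟩ : Game Ω) = pullback θ (φ ν)
  positivity : ∀ ν : V, Monotone (ν : Game Ω) → 0 ≤ φ ν
  identity : ∀ ν : V, (ν : Game Ω) ∈ NA Ω → (φ ν : Game Ω) = ν

/-- A Milnor semivalue: a semivalue that is a Milnor operator. -/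
def IsMilnorSemivalue (V : Submodule ℝ (Game Ω)) (φ : V →ₗ[ℝ] NA Ω) : Prop :=
  IsMilnorOperator V φ ∧ IsSemivalue V φ

/-- `ψ : AC_∞ → NA` is a `‖·‖_∞`-continuous linear Milnor operator that extends the
Burkill-Cesari integral on `Q` (`NA ⊆ AC_∞` carries the norm `‖·‖_∞`). -/
structure IsContinuousMilnorExtension (ψ : lipGames Ω →ₗ[ℝ] NA Ω) : Prop where
  milnor : IsMilnorOperator (lipGames Ω) ψ
  continuous : Continuous fun ν => Submodule.inclusion NA_le_lipGames (ψ ν)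
  extends_BC : ∀ ν : lipGames Ω, (ν : Game Ω) ∈ Q Ω →
    IsBCIntegral (ν : Game Ω) (ψ ν : Game Ω)

end Nonatomic

end TUGame

end

noncomputable section

namespace TUGame

/-! The Burkill-Cesari integral is a limit of partition sums `∑ ν(I ∩ E)`. If `-μ ⪯ ν ⪯ μ`, these
sums stay in `[-μ(E), μ(E)]`, so along an ultrafilter finer than the refinement filter they converge
for every Lipschitz game (`tendsto_partitionLimit`), and the limit is linear in `ν`. It is additive
in `E`, because fine enough partitions split any given coalition, and it is bounded by `μ`, which
forces countable additivity and nonatomicity (`mem_NA_of_abs_le`). Every dominator of `ν` dominates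
the limit, so the operator is a contraction. Nonatomicity provides partitions of small mesh
(`exists_parts_lt`), and refining keeps the mesh small, so on `Q` the limit is the Burkill-Cesari
integral.

Measures have constant partition sums, so setwise bounds by measures pass to the limit. This gives
the Milnor inequalities once `ν^*` and `ν_*` are known to exist. For `ν^*`, the supremum of the
marginal contributions of `E` is subadditive in `E`, and its own partition limit is the least
measure above it (`exists_isLeast_upperMeasures`); `ν_*` follows by negation.

For the second claim the extension is arbitrary. Positivity and identity on `NA` come from the
Milnor bounds alone. Symmetry holds on `Q` because the Burkill-Cesari integral is unique and
transported by automorphisms, and it passes to the closure by continuity. -/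

/-! ### Sums over finite partitions -/

open scoped Classical in
theorem Game.apply_sup_le_sum {Ω : Type*} [MeasurableSpace Ω] (f : Game Ω)
    (hf : ∀ S T : Coalition Ω, Disjoint S T → f (S ⊔ T) ≤ f S + f T)
    (s : Finset (Coalition Ω)) (hs : (s : Set (Coalition Ω)).PairwiseDisjoint id) :
    f (s.sup id) ≤ ∑ I ∈ s, f I := by
  induction s using Finset.induction_on with
  | empty => simp
  | insert a s ha ih =>
    rw [Finset.sup_insert, Finset.sum_insert ha]
    have hd : Disjoint a (s.sup id) := by
      rw [Finset.disjoint_sup_right]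
      intro b hb
      exact hs (by simp) (by simp [hb]) (fun h => ha (h ▸ hb))
    have h1 := ih (hs.subset (by simp))
    have h2 := hf _ _ hd
    simp only [id] at h2 ⊢
    linarith

theorem Game.le_sum_parts {Ω : Type*} [MeasurableSpace Ω] {f : Game Ω}
    (hf : ∀ S T : Coalition Ω, Disjoint S T → f (S ⊔ T) ≤ f S + f T)
    {E : Coalition Ω} (D : Finpartition E) : f E ≤ ∑ I ∈ D.parts, f I := by
  have := f.apply_sup_le_sum hf D.parts D.disjoint
  rwa [D.sup_parts] at this

theorem Game.sum_parts {Ω : Type*} [MeasurableSpace Ω] {f : Game Ω}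
    (hf : ∀ S T : Coalition Ω, Disjoint S T → f (S ⊔ T) = f S + f T)
    {E : Coalition Ω} (D : Finpartition E) : ∑ I ∈ D.parts, f I = f E := by
  refine le_antisymm ?_ (Game.le_sum_parts (fun S T h => (hf S T h).le) D)
  have := Game.le_sum_parts (f := -f) (fun S T h => by
    rw [Game.neg_apply, hf S T h, Game.neg_apply, Game.neg_apply, neg_add]) D
  simp only [Game.neg_apply, Finset.sum_neg_distrib] at this
  linarith

open scoped Classical in
/-- The partition that a finite partition of `⊤` induces on a coalition. -/
def trace {Ω : Type*} [MeasurableSpace Ω] (D : Finpartition (⊤ : Coalition Ω))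
    (E : Coalition Ω) : Finpartition E := D.restrict le_top

theorem sum_trace {Ω : Type*} [MeasurableSpace Ω] (D : Finpartition (⊤ : Coalition Ω))
    (E : Coalition Ω) (f : Game Ω) :
    ∑ I ∈ (trace D E).parts, f I = ∑ I ∈ D.parts, f (I ⊓ E) :=
  D.sum_restrict le_top _ f.bot_apply

theorem exists_le_of_mem_trace {Ω : Type*} [MeasurableSpace Ω]
    {D : Finpartition (⊤ : Coalition Ω)} {E I : Coalition Ω} (hI : I ∈ (trace D E).parts) :
    ∃ J ∈ D.parts, I ≤ J := by
  simp only [trace, Finpartition.restrict, Finset.mem_erase, Finset.mem_image] at hI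
  obtain ⟨-, J, hJ, rfl⟩ := hI
  exact ⟨J, hJ, inf_le_left⟩

-- Makes membership in `A` decided piece by piece for all sufficiently fine partitions; this is what
-- gives additivity of limits under refinement.
open scoped Classical in
theorem exists_split {Ω : Type*} [MeasurableSpace Ω] (A : Coalition Ω) :
    ∃ P : Finpartition (⊤ : Coalition Ω), ∀ D ≤ P, ∀ I ∈ D.parts, I ≤ A ∨ Disjoint I A := by
  -- `ofErase` discards the empty member that occurs when `A` is `⊥` or `⊤`.
  refine ⟨Finpartition.ofErase {A, Aᶜ} ?_ (by simp), fun D hD I hI => ?_⟩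
  · rw [Finset.supIndep_iff_pairwiseDisjoint]
    simp only [Finset.coe_insert, Finset.coe_singleton]
    exact Set.pairwise_pair.2 fun _ => ⟨disjoint_compl_right, disjoint_compl_left⟩
  · obtain ⟨J, hJ, hIJ⟩ := hD hI
    simp only [Finpartition.ofErase, Finset.mem_erase, Finset.mem_insert,
      Finset.mem_singleton] at hJ
    rcases hJ.2 with rfl | rfl
    · exact Or.inl hIJ
    · exact Or.inr (disjoint_compl_left.mono_left hIJ)

section Nonatomic

variable {Ω : Type*} [MeasurableSpace Ω] [StandardBorelSpace Ω]

/-! ### Nonatomic measures and partitions of small mesh -/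

theorem NA.apply_sup {lam : Game Ω} (h : lam ∈ NA Ω) {S T : Coalition Ω} (hST : Disjoint S T) :
    lam (S ⊔ T) = lam S + lam T := by
  obtain ⟨⟨m, hm⟩, -⟩ := h
  rw [hm, hm, hm, ← VectorMeasure.of_union _ S.2 T.2]
  · rfl
  · rw [Set.disjoint_iff]
    exact fun x hx => (hST.le_bot : S ⊓ T ≤ ⊥) hx

theorem NA.apply_sub {lam : Game Ω} (h : lam ∈ NA Ω) {S T : Coalition Ω} (hST : S ≤ T) :
    lam T - lam S = lam (T \ S) := by
  have := NA.apply_sup h (disjoint_sdiff_self_right : Disjoint S (T \ S))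
  rw [sup_sdiff_cancel_right hST] at this
  linarith

theorem NA.sum_parts {lam : Game Ω} (h : lam ∈ NA Ω) {E : Coalition Ω} (D : Finpartition E) :
    ∑ I ∈ D.parts, lam I = lam E :=
  Game.sum_parts (fun _ _ => NA.apply_sup h) D

theorem NA.sum_inf {lam : Game Ω} (h : lam ∈ NA Ω) (D : Finpartition (⊤ : Coalition Ω))
    (E : Coalition Ω) : ∑ I ∈ D.parts, lam (I ⊓ E) = lam E := by
  rw [← sum_trace, NA.sum_parts h]

theorem Game.Dominated.abs_le {ν μ : Game Ω} (h : ν.Dominated μ) (S : Coalition Ω) :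
    |ν S| ≤ μ S := by
  simpa using Game.dominated_iff.1 h ⊥ S bot_le

/-- Finer and finer partitions that eventually separate any two points. -/
theorem exists_separating_partitions (Ω : Type*) [MeasurableSpace Ω] [StandardBorelSpace Ω] :
    ∃ D : ℕ → Finpartition (⊤ : Coalition Ω), (∀ n, D (n + 1) ≤ D n) ∧
      ∀ x y : Ω, x ≠ y → ∃ n, ∀ I ∈ (D n).parts, x ∈ (I : Set Ω) → y ∉ (I : Set Ω) := by
  classical
  let A : ℕ → Coalition Ω := fun n => ⟨MeasurableSpace.natGeneratingSequence Ω n,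
    MeasurableSpace.measurableSet_natGeneratingSequence n⟩
  choose P hP using fun n => exists_split (A n)
  let D : ℕ → Finpartition (⊤ : Coalition Ω) := fun n => Nat.rec (P 0) (fun k T => T ⊓ P k) n
  refine ⟨D, fun n => inf_le_left, fun x y hxy => ?_⟩
  have h1 : ∃ n, ¬ (x ∈ (A n : Set Ω) ↔ y ∈ (A n : Set Ω)) := by
    by_contra! hcon
    refine hxy (MeasurableSpace.injective_mapNatBool Ω ?_)
    funext n
    simpa [MeasurableSpace.mapNatBool, A] using hcon n
  obtain ⟨n, hn⟩ := h1
  refine ⟨n + 1, fun I hI hx hy => hn ?_⟩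
  rcases hP n (D (n + 1)) inf_le_right I hI with h | h
  · exact ⟨fun _ => h hy, fun _ => h hx⟩
  · exact ⟨fun hxA => absurd ⟨hx, hxA⟩ fun hh => (h.le_bot : I ⊓ A n ≤ ⊥) hh,
      fun hyA => absurd ⟨hy, hyA⟩ fun hh => (h.le_bot : I ⊓ A n ≤ ⊥) hh⟩

/-- Along separating partitions, the parts containing a fixed point shrink to that point, which is
null. Hence the unions of the large parts decrease to `∅` and their measures tend to `0`; once below
`δ`, no large part is left. -/
theorem exists_parts_lt {μ : Game Ω} (hμ : μ ∈ NAplus Ω) {δ : ℝ} (hδ : 0 < δ) :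
    ∃ D : Finpartition (⊤ : Coalition Ω), ∀ I ∈ D.parts, μ I < δ := by
  classical
  obtain ⟨D, hD, hsep⟩ := exists_separating_partitions Ω
  have hmono := NAplus.monotone hμ
  obtain ⟨⟨⟨m, hm⟩, hna⟩, -⟩ := hμ
  -- the union of the parts that are still large
  let A : ℕ → Set Ω := fun n => ⋃ I ∈ (D n).parts.filter (fun I => δ ≤ μ I), (I : Set Ω)
  have hmem : ∀ n x, x ∈ A n ↔ ∃ I ∈ (D n).parts, δ ≤ μ I ∧ x ∈ (I : Set Ω) := by
    intro n x
    simp only [A, Set.mem_iUnion, Finset.mem_filter, exists_prop, and_assoc]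
  have hAmeas : ∀ n, MeasurableSet (A n) := fun n =>
    Finset.measurableSet_biUnion _ fun I _ => I.2
  have hanti : Antitone A := by
    refine antitone_nat_of_succ_le fun n x hx => ?_
    obtain ⟨I, hI, hIδ, hxI⟩ := (hmem _ _).1 hx
    obtain ⟨J, hJ, hIJ⟩ := hD n hI
    exact (hmem _ _).2 ⟨J, hJ, hIδ.trans (hmono hIJ), hIJ hxI⟩
  have hempty : ⋂ n, A n = ∅ := by
    rw [Set.eq_empty_iff_forall_notMem]
    intro x hx
    choose I hI hIδ hxI using fun n => (hmem n x).1 (Set.mem_iInter.1 hx n)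
    have hIanti : Antitone fun n => (I n : Set Ω) := by
      refine antitone_nat_of_succ_le fun n => ?_
      obtain ⟨J, hJ, hIJ⟩ := hD n (hI (n + 1))
      -- Both parts of `D n` contain `x`.
      have : J = I n := by
        by_contra hne
        exact ((D n).disjoint hJ (hI n) hne).le_bot ⟨hIJ (hxI (n + 1)), hxI n⟩
      exact this ▸ hIJ
    have hinter : ⋂ n, (I n : Set Ω) = {x} := by
      refine Set.Subset.antisymm (fun y hy => ?_) (by simpa using hxI)
      by_contra hne
      obtain ⟨n, hn⟩ := hsep x y fun h => hne h.symm
      exact hn _ (hI n) (hxI n) (Set.mem_iInter.1 hy n)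
    have hlim := VectorMeasure.tendsto_vectorMeasure_iInter_atTop_nat (v := m) hIanti
      (fun n => (I n).2)
    rw [hinter] at hlim
    have h0 : m {x} = 0 := by
      rw [← hna.single_eq_zero x, hm]; rfl
    have := ge_of_tendsto' hlim (b := δ) fun n => by simpa [hm] using hIδ n
    linarith
  have hlim := VectorMeasure.tendsto_vectorMeasure_iInter_atTop_nat (v := m) hanti hAmeas
  rw [hempty, VectorMeasure.empty] at hlim
  obtain ⟨n, hn⟩ := (hlim.eventually_lt_const hδ).exists
  refine ⟨D n, fun I hI => ?_⟩
  by_contra! hcon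
  have hsub : I ≤ ⟨A n, hAmeas n⟩ := fun x hx => (hmem _ _).2 ⟨I, hI, hcon, hx⟩
  have h1 := hmono hsub
  rw [hm ⟨A n, hAmeas n⟩] at h1
  change μ I ≤ m (A n) at h1
  linarith

/-! ### Uniqueness of the Burkill-Cesari integral -/

theorem mesh_trace_lt {μ : Game Ω} (hμ : μ ∈ NAplus Ω) {δ : ℝ} (hδ : 0 < δ)
    {D : Finpartition (⊤ : Coalition Ω)} (hD : ∀ I ∈ D.parts, μ I < δ) (E : Coalition Ω) :
    mesh μ (trace D E) < δ := by
  rw [mesh_lt_iff _ _ hδ]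
  intro I hI
  obtain ⟨J, hJ, hIJ⟩ := exists_le_of_mem_trace hI
  exact (NAplus.monotone hμ hIJ).trans_lt (hD J hJ)

/-- The Burkill-Cesari integral does not depend on the mesh. -/
theorem IsBCLimit.unique {μ μ' ν : Game Ω} (hμ : μ ∈ NAplus Ω) (hμ' : μ' ∈ NAplus Ω)
    {E : Coalition Ω} {L L' : ℝ} (h : IsBCLimit μ ν E L) (h' : IsBCLimit μ' ν E L') :
    L = L' := by
  refine eq_of_forall_dist_le fun ε hε => ?_
  -- Both limits persist for the mesh of `μ + μ'`, so one fine partition compares them.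
  obtain ⟨δ, hδ, hD⟩ := h.of_le (μ' := μ + μ')
    (Game.le_def.2 fun S => le_add_of_nonneg_right (hμ'.2 S)) (ε / 2) (half_pos hε)
  obtain ⟨δ', hδ', hD'⟩ := h'.of_le (μ' := μ + μ')
    (Game.le_def.2 fun S => le_add_of_nonneg_left (hμ.2 S)) (ε / 2) (half_pos hε)
  have hmin := lt_min hδ hδ'
  obtain ⟨D, hlt⟩ := exists_parts_lt (NAplus.add hμ hμ') hmin
  have hmesh := mesh_trace_lt (NAplus.add hμ hμ') hmin hlt E
  have h1 := abs_lt.1 (hD _ (hmesh.trans_le (min_le_left _ _)))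
  have h2 := abs_lt.1 (hD' _ (hmesh.trans_le (min_le_right _ _)))
  rw [Real.dist_eq, abs_le]
  constructor <;> linarith [h1.1, h1.2, h2.1, h2.2]

theorem IsBCIntegral.unique {ν : Game Ω} {m m' : Coalition Ω → ℝ} (h : IsBCIntegral ν m)
    (h' : IsBCIntegral ν m') : m = m' := by
  obtain ⟨μ, hμ, h⟩ := h
  obtain ⟨μ', hμ', h'⟩ := h'
  exact funext fun E => IsBCLimit.unique hμ hμ' (h E) (h' E)

/-- A finitely additive game that is bounded by a nonatomic measure is a nonatomic measure. -/
theorem mem_NA_of_abs_le {f μ : Game Ω} (hμ : μ ∈ NAplus Ω)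
    (hf : ∀ S T : Coalition Ω, Disjoint S T → f (S ⊔ T) = f S + f T)
    (hle : ∀ S, |f S| ≤ μ S) : f ∈ NA Ω := by
  classical
  obtain ⟨⟨m, hm⟩, hna⟩ := hμ.1
  let v : Set Ω → ℝ := fun S => if h : MeasurableSet S then f ⟨S, h⟩ else 0
  have hv : ∀ S : Coalition Ω, v S = f S := fun S => dif_pos S.2
  have hvm : ∀ S : Set Ω, MeasurableSet S → |v S| ≤ m S := by
    intro S hS
    have := hle ⟨S, hS⟩
    rw [hm, ← hv] at this
    exact this
  have hadd : ∀ S T : Set Ω, MeasurableSet S → MeasurableSet T → Disjoint S T →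
      v (S ∪ T) = v S + v T := by
    intro S T hS hT hST
    have := hf ⟨S, hS⟩ ⟨T, hT⟩ (by
      rw [disjoint_iff_inf_le]
      exact fun x hx => hST.le_bot hx)
    rw [← hv, ← hv, ← hv] at this
    exact this
  have hmeas : f.IsMeasure := by
    refine ⟨⟨v, ?_, fun S hS => dif_neg hS, fun A hA hd => ?_⟩, fun S => (hv S).symm⟩
    · exact (hv ⊥).trans f.bot_apply
    -- Finite additivity writes the remainder of the series as the value on the tail. There `m`
    -- bounds `v`, and the tails of `m` vanish because `m` is countably additive.
    · have hfin : ∀ s : Finset ℕ, v (⋃ i, A i) - ∑ i ∈ s, v (A i)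
          = v (⋃ i ∈ (s : Set ℕ)ᶜ, A i) := by
        intro s
        induction s using Finset.induction_on with
        | empty => simp
        | insert a s ha ih =>
          rw [Finset.sum_insert ha]
          have hset : ⋃ i ∈ (s : Set ℕ)ᶜ, A i
              = A a ∪ ⋃ i ∈ ((insert a s : Finset ℕ) : Set ℕ)ᶜ, A i := by
            rw [← Set.biUnion_insert]
            refine Set.iUnion_congr fun i => Set.iUnion_congr_Prop ?_ fun _ => rfl
            simp only [Finset.coe_insert, Set.mem_compl_iff, Set.mem_insert_iff, Finset.mem_coe]
            by_cases h : i = a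
            · simp [h, ha]
            · simp [h]
          have hdis : Disjoint (A a) (⋃ i ∈ ((insert a s : Finset ℕ) : Set ℕ)ᶜ, A i) := by
            rw [Set.disjoint_iUnion₂_right]
            intro i hi
            exact hd fun h => hi (by simp [h])
          have := hadd _ _ (hA a) (MeasurableSet.biUnion (Set.to_countable _) fun i _ => hA i) hdis
          rw [← hset] at this
          linarith
      have hmfin : ∀ s : Finset ℕ, m (⋃ i, A i) - ∑ i ∈ s, m (A i)
          = m (⋃ i ∈ (s : Set ℕ)ᶜ, A i) := by
        intro s
        have h1 : ∑ i ∈ s, m (A i) = m (⋃ i ∈ s, A i) :=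
          (VectorMeasure.of_biUnion_finset (fun i _ j _ h => hd h) fun i _ => hA i).symm
        have hset : ⋃ i, A i = (⋃ i ∈ s, A i) ∪ ⋃ i ∈ (s : Set ℕ)ᶜ, A i := by
          ext x
          simp only [Set.mem_iUnion, Set.mem_union, Set.mem_compl_iff, Finset.mem_coe]
          constructor
          · rintro ⟨i, hi⟩
            by_cases h : i ∈ s
            · exact Or.inl ⟨i, h, hi⟩
            · exact Or.inr ⟨i, h, hi⟩
          · rintro (⟨i, -, hi⟩ | ⟨i, -, hi⟩) <;> exact ⟨i, hi⟩
        have hdis : Disjoint (⋃ i ∈ s, A i) (⋃ i ∈ (s : Set ℕ)ᶜ, A i) := by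
          rw [Set.disjoint_iUnion₂_right]
          intro i hi
          rw [Set.disjoint_iUnion₂_left]
          intro j hj
          exact hd fun h => hi (h ▸ hj)
        rw [h1, hset, VectorMeasure.of_union hdis (Finset.measurableSet_biUnion _ fun i _ => hA i)
          (MeasurableSet.biUnion (Set.to_countable _) fun i _ => hA i)]
        ring
      have hm0 : Tendsto (fun s : Finset ℕ => m (⋃ i, A i) - ∑ i ∈ s, m (A i)) atTop (𝓝 0) := by
        have := (m.m_iUnion hA hd : Tendsto _ _ _).const_sub (m (⋃ i, A i))
        rwa [sub_self] at this
      have hv0 : Tendsto (fun s : Finset ℕ => v (⋃ i, A i) - ∑ i ∈ s, v (A i)) atTop (𝓝 0) := by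
        refine squeeze_zero_norm (fun s => ?_) hm0
        rw [hfin, hmfin]
        exact hvm _ (MeasurableSet.biUnion (Set.to_countable _) fun i _ => hA i)
      have := hv0.const_sub (v (⋃ i, A i))
      simp only [sub_sub_cancel, sub_zero] at this
      exact this
  refine ⟨hmeas, hmeas.isNonatomic fun x => ?_⟩
  have := hle (single x)
  rw [hna.single_eq_zero] at this
  exact abs_eq_zero.1 (le_antisymm this (abs_nonneg _))

/-! ### Limits of partition sums along an ultrafilter -/

/-- Finer partitions are smaller, so `atBot` is convergence under refinement; common refinements
make it proper. -/
instance (Ω : Type*) [MeasurableSpace Ω] :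
    (atBot : Filter (Finpartition (⊤ : Coalition Ω))).NeBot := by
  classical
  exact atBot_neBot

/-- An ultrafilter on the finite partitions of `⊤` that converges under refinement. -/
def refinement (Ω : Type*) [MeasurableSpace Ω] : Ultrafilter (Finpartition (⊤ : Coalition Ω)) :=
  Ultrafilter.of atBot

theorem refinement_le_atBot (Ω : Type*) [MeasurableSpace Ω] :
    (refinement Ω : Filter (Finpartition (⊤ : Coalition Ω))) ≤ atBot := Ultrafilter.of_le _

/-- The sum of the values of `f` on the pieces into which `D` cuts `E`. -/
def partitionSum (f : Game Ω) (E : Coalition Ω) (D : Finpartition (⊤ : Coalition Ω)) : ℝ :=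
  ∑ I ∈ D.parts, f (I ⊓ E)

/-- The limit of the partition sums of `f`. -/
def partitionLimit (f : Game Ω) : Game Ω :=
  Game.mk (fun E => limUnder (refinement Ω : Filter _) (partitionSum f E)) (by
    have : partitionSum f ⊥ = fun _ => 0 := by
      funext D
      simp [partitionSum]
    rw [this]
    exact tendsto_const_nhds.limUnder_eq)

theorem abs_partitionSum_le {f μ : Game Ω} (hμ : μ ∈ NAplus Ω) (hf : ∀ S, |f S| ≤ μ S)
    (E : Coalition Ω) (D : Finpartition (⊤ : Coalition Ω)) : |partitionSum f E D| ≤ μ E :=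
  calc |partitionSum f E D| ≤ ∑ I ∈ D.parts, |f (I ⊓ E)| := Finset.abs_sum_le_sum_abs _ _
    _ ≤ ∑ I ∈ D.parts, μ (I ⊓ E) := Finset.sum_le_sum fun _ _ => hf _
    _ = μ E := NA.sum_inf hμ.1 D E

/-- An ultrafilter on the compact interval `[-μ E, μ E]` converges. Without such a bound `limUnder`
may be a junk value. -/
theorem tendsto_partitionLimit {f μ : Game Ω} (hμ : μ ∈ NAplus Ω) (hf : ∀ S, |f S| ≤ μ S)
    (E : Coalition Ω) :
    Tendsto (partitionSum f E) (refinement Ω) (𝓝 (partitionLimit f E)) := by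
  refine tendsto_nhds_limUnder ?_
  obtain ⟨x, -, hx⟩ := (isCompact_Icc (a := -μ E) (b := μ E)).ultrafilter_le_nhds
    ((refinement Ω).map (partitionSum f E)) (by
      rw [le_principal_iff, Ultrafilter.coe_map, mem_map]
      exact Eventually.of_forall fun D => abs_le.1 (abs_partitionSum_le hμ hf E D))
  exact ⟨x, hx⟩

theorem abs_partitionLimit_le {f μ : Game Ω} (hμ : μ ∈ NAplus Ω) (hf : ∀ S, |f S| ≤ μ S)
    (E : Coalition Ω) : |partitionLimit f E| ≤ μ E :=
  le_of_tendsto' (tendsto_partitionLimit hμ hf E).abs (abs_partitionSum_le hμ hf E)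

/-- Once a partition refines the splitting by `S`, each piece meets at most one of `S` and `T`, so
the partition sums themselves add up. -/
theorem partitionLimit_sup {f μ : Game Ω} (hμ : μ ∈ NAplus Ω) (hf : ∀ S, |f S| ≤ μ S)
    {S T : Coalition Ω} (hST : Disjoint S T) :
    partitionLimit f (S ⊔ T) = partitionLimit f S + partitionLimit f T := by
  refine tendsto_nhds_unique (tendsto_partitionLimit hμ hf _)
    (((tendsto_partitionLimit hμ hf S).add (tendsto_partitionLimit hμ hf T)).congr' ?_)
  obtain ⟨P, hP⟩ := exists_split S
  filter_upwards [refinement_le_atBot Ω (eventually_le_atBot P)] with D hD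
  rw [partitionSum, partitionSum, partitionSum, ← Finset.sum_add_distrib]
  refine Finset.sum_congr rfl fun I hI => ?_
  rcases hP D hD I hI with h | h
  · rw [inf_eq_left.2 h, inf_eq_left.2 (h.trans le_sup_left), (hST.mono_left h).eq_bot,
      Game.bot_apply, add_zero]
  · rw [inf_sup_left, h.eq_bot, bot_sup_eq, Game.bot_apply, zero_add]

theorem partitionLimit_mem_NA {f μ : Game Ω} (hμ : μ ∈ NAplus Ω) (hf : ∀ S, |f S| ≤ μ S) :
    partitionLimit f ∈ NA Ω :=
  mem_NA_of_abs_le hμ (fun _ _ => partitionLimit_sup hμ hf) (abs_partitionLimit_le hμ hf)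

theorem partitionLimit_le {f μ lam : Game Ω} (hμ : μ ∈ NAplus Ω) (hf : ∀ S, |f S| ≤ μ S)
    (hlam : lam ∈ NA Ω) (hle : f ≤ lam) : partitionLimit f ≤ lam := fun E =>
  le_of_tendsto' (tendsto_partitionLimit hμ hf E) fun D =>
    (Finset.sum_le_sum fun I _ => hle (I ⊓ E)).trans_eq (NA.sum_inf hlam D E)

theorem le_partitionLimit_of_le {f μ lam : Game Ω} (hμ : μ ∈ NAplus Ω) (hf : ∀ S, |f S| ≤ μ S)
    (hlam : lam ∈ NA Ω) (hle : lam ≤ f) : lam ≤ partitionLimit f := fun E =>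
  ge_of_tendsto' (tendsto_partitionLimit hμ hf E) fun D =>
    (NA.sum_inf hlam D E).symm.trans_le (Finset.sum_le_sum fun I _ => hle (I ⊓ E))

theorem le_partitionLimit_of_subadditive {f μ : Game Ω} (hμ : μ ∈ NAplus Ω)
    (hf : ∀ S, |f S| ≤ μ S)
    (hsub : ∀ S T : Coalition Ω, Disjoint S T → f (S ⊔ T) ≤ f S + f T) :
    f ≤ partitionLimit f := fun E =>
  ge_of_tendsto' (tendsto_partitionLimit hμ hf E) fun D =>
    (Game.le_sum_parts hsub (trace D E)).trans_eq (sum_trace D E f)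

/-- Increments of a measure are its values on differences, so a setwise bound is already domination.
-/
theorem partitionLimit_dominated {f μ : Game Ω} (hμ : μ ∈ NAplus Ω) (hf : ∀ S, |f S| ≤ μ S) :
    (partitionLimit f).Dominated μ := by
  rw [Game.dominated_iff]
  intro S T hST
  rw [NA.apply_sub (partitionLimit_mem_NA hμ hf) hST, NA.apply_sub hμ.1 hST]
  exact abs_partitionLimit_le hμ hf _

/-- A partition of small mesh exists, and all its refinements and their traces on `E` have small
mesh too; so the mesh limit is also a limit under refinement. -/
theorem partitionLimit_eq_of_isBCIntegral {f μ : Game Ω} (hμ : μ ∈ NAplus Ω)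
    (hf : ∀ S, |f S| ≤ μ S) {m : Coalition Ω → ℝ} (h : IsBCIntegral f m) :
    ⇑(partitionLimit f) = m := by
  obtain ⟨μ', hμ', h⟩ := h
  funext E
  refine tendsto_nhds_unique (tendsto_partitionLimit hμ hf E) ?_
  rw [Metric.tendsto_nhds]
  intro ε hε
  obtain ⟨δ, hδ, hD⟩ := h E ε hε
  obtain ⟨P, hP⟩ := exists_parts_lt hμ' hδ
  filter_upwards [refinement_le_atBot Ω (eventually_le_atBot P)] with D hDP
  rw [Real.dist_eq, partitionSum, ← sum_trace]
  refine hD _ (mesh_trace_lt hμ' hδ (fun I hI => ?_) E)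
  obtain ⟨J, hJ, hIJ⟩ := hDP hI
  exact (NAplus.monotone hμ' hIJ).trans_lt (hP J hJ)

/-! ### The least measure above a Lipschitz game -/

theorem Game.Prec.le {Ω : Type*} [MeasurableSpace Ω] {ν ν' : Game Ω} (h : Game.Prec ν ν') : ν ≤ ν' := fun S => by
  have := h (bot_le : ⊥ ≤ S)
  rw [Game.bot_apply, Game.sub_apply] at this
  exact sub_nonneg.1 this

theorem abs_apply_sup_sub_le {ν μ : Game Ω} (hμ : μ ∈ NAplus Ω) (h : ν.Dominated μ)
    (E S : Coalition Ω) : |ν (S ⊔ E) - ν (S \ E)| ≤ μ E := by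
  have hle : S \ E ≤ S ⊔ E := sdiff_le.trans le_sup_left
  have h1 := Game.dominated_iff.1 h _ _ hle
  rwa [NA.apply_sub hμ.1 hle, show (S ⊔ E) \ (S \ E) = E by
    rw [← sdiff_sup_self, sup_sdiff_left_self, sdiff_eq_left]; exact disjoint_sdiff_self_right]
    at h1

/-- The largest marginal contribution of a coalition. -/
def maxMarginal (ν : Game Ω) : Game Ω :=
  -- Writing `S ⊔ E` and `S \ E` lets `S` range over all coalitions, with no disjointness condition.
  Game.mk (fun E => ⨆ S : Coalition Ω, (ν (S ⊔ E) - ν (S \ E))) (by simp)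

theorem le_maxMarginal {ν μ : Game Ω} (hμ : μ ∈ NAplus Ω) (h : ν.Dominated μ)
    (E S : Coalition Ω) : ν (S ⊔ E) - ν (S \ E) ≤ maxMarginal ν E :=
  le_ciSup (f := fun S : Coalition Ω => ν (S ⊔ E) - ν (S \ E))
    ⟨μ E, by rintro _ ⟨T, rfl⟩; exact (abs_le.1 (abs_apply_sup_sub_le hμ h E T)).2⟩ S

theorem abs_maxMarginal_le {ν μ : Game Ω} (hμ : μ ∈ NAplus Ω) (h : ν.Dominated μ)
    (E : Coalition Ω) : |maxMarginal ν E| ≤ μ E := by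
  rw [abs_le]
  exact ⟨(abs_le.1 (abs_apply_sup_sub_le hμ h E ⊥)).1.trans (le_maxMarginal hμ h E ⊥),
    ciSup_le fun T => (abs_le.1 (abs_apply_sup_sub_le hμ h E T)).2⟩

/-- Adding `E ⊔ F` to `S \ (E ⊔ F)` can be done by adding first `E` and then `F`; the two
contributions telescope through `(S \ F) ⊔ E`. -/
theorem maxMarginal_sup_le {ν μ : Game Ω} (hμ : μ ∈ NAplus Ω) (h : ν.Dominated μ)
    {E F : Coalition Ω} (hEF : Disjoint E F) :
    maxMarginal ν (E ⊔ F) ≤ maxMarginal ν E + maxMarginal ν F := by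
  refine ciSup_le fun S => ?_
  have h1 := le_maxMarginal hμ h F (S ⊔ E)
  have h2 := le_maxMarginal hμ h E (S \ F)
  rw [sup_sdiff, hEF.sdiff_eq_left, sup_assoc] at h1
  rw [sdiff_sdiff_left, sup_comm F E] at h2
  linarith

theorem maxMarginal_le_of_prec {ν lam : Game Ω} (hlam : lam ∈ NA Ω) (h : Game.Prec ν lam) :
    maxMarginal ν ≤ lam := fun E => by
  refine ciSup_le fun S => ?_
  have hle : S \ E ≤ S ⊔ E := sdiff_le.trans le_sup_left
  have h1 := h hle
  have h2 := NA.apply_sub hlam hle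
  rw [show (S ⊔ E) \ (S \ E) = E by
    rw [← sdiff_sup_self, sup_sdiff_left_self, sdiff_eq_left]; exact disjoint_sdiff_self_right]
    at h2
  simp only [Game.sub_apply] at h1
  change _ ≤ lam E
  linarith

/-- For a measure `lam`, `ν ⪯ lam` amounts to `maxMarginal ν ≤ lam` setwise. By subadditivity the
partition limit of `maxMarginal ν` lies above it, and it lies below every measure that does. -/
theorem exists_isLeast_upperMeasures {ν : Game Ω} (hν : ν ∈ lipGames Ω) :
    ∃ hi : NA Ω, IsLeast (upperMeasures ν) hi := by
  obtain ⟨-, μ, hμ, h⟩ := hν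
  have hb := abs_maxMarginal_le hμ h
  have hNA := partitionLimit_mem_NA hμ hb
  refine ⟨⟨partitionLimit (maxMarginal ν), hNA⟩, fun S T hST => ?_, fun lam hlam => ?_⟩
  · have h1 := le_maxMarginal hμ h (T \ S) S
    have h2 := le_partitionLimit_of_subadditive hμ hb (fun _ _ => maxMarginal_sup_le hμ h) (T \ S)
    have h3 := NA.apply_sub hNA hST
    rw [sup_sdiff_cancel_right hST, disjoint_sdiff_self_right.sdiff_eq_left] at h1
    change maxMarginal ν (T \ S) ≤ partitionLimit (maxMarginal ν) (T \ S) at h2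
    simp only [Game.sub_apply]
    linarith
  · exact partitionLimit_le hμ hb lam.2 (maxMarginal_le_of_prec lam.2 hlam)

theorem mem_lowerMeasures_iff {ν : Game Ω} {lam : NA Ω} :
    lam ∈ lowerMeasures ν ↔ -lam ∈ upperMeasures (-ν) := by
  have : (lam : Game Ω).Prec ν ↔ Game.Prec (-ν) (-lam : Game Ω) := by
    rw [Game.Prec, Game.Prec, neg_sub_neg]
  exact this

theorem exists_isGreatest_lowerMeasures {ν : Game Ω} (hν : ν ∈ lipGames Ω) :
    ∃ lo : NA Ω, IsGreatest (lowerMeasures ν) lo := by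
  obtain ⟨hi, h1, h2⟩ := exists_isLeast_upperMeasures (neg_mem hν)
  refine ⟨-hi, mem_lowerMeasures_iff.2 (by rwa [neg_neg]), fun lam hlam S => ?_⟩
  have := h2 (mem_lowerMeasures_iff.1 hlam) S
  exact le_neg_of_le_neg this

/-! ### The extension of the Burkill-Cesari integral -/

theorem exists_abs_le (ν : lipGames Ω) : ∃ μ ∈ NAplus Ω, ∀ S, |(ν : Game Ω) S| ≤ μ S := by
  obtain ⟨-, μ, hμ, h⟩ := ν.2
  exact ⟨μ, hμ, h.abs_le⟩

/-- The limit of the partition sums as a linear operator on the Lipschitz games. -/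
def limitOperator (Ω : Type*) [MeasurableSpace Ω] [StandardBorelSpace Ω] :
    lipGames Ω →ₗ[ℝ] NA Ω where
  toFun ν := ⟨partitionLimit (ν : Game Ω), by
    obtain ⟨μ, hμ, h⟩ := exists_abs_le ν
    exact partitionLimit_mem_NA hμ h⟩
  map_add' ν ν' := by
    refine Subtype.ext (Game.ext fun E => ?_)
    obtain ⟨μ, hμ, h⟩ := exists_abs_le ν
    obtain ⟨μ', hμ', h'⟩ := exists_abs_le ν'
    obtain ⟨μs, hμs, hs⟩ := exists_abs_le (ν + ν')
    -- The three bounds only certify convergence; the partition sums are linear in the game.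
    refine tendsto_nhds_unique (tendsto_partitionLimit hμs hs E)
      (((tendsto_partitionLimit hμ h E).add (tendsto_partitionLimit hμ' h' E)).congr fun D => ?_)
    exact Finset.sum_add_distrib.symm
  map_smul' c ν := by
    refine Subtype.ext (Game.ext fun E => ?_)
    obtain ⟨μ, hμ, h⟩ := exists_abs_le ν
    obtain ⟨μs, hμs, hs⟩ := exists_abs_le (c • ν)
    refine tendsto_nhds_unique (tendsto_partitionLimit hμs hs E)
      (((tendsto_partitionLimit hμ h E).const_mul c).congr fun D => ?_)
    exact Finset.mul_sum _ _ _

theorem limitOperator_coe (ν : lipGames Ω) :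
    (limitOperator Ω ν : Game Ω) = partitionLimit (ν : Game Ω) := rfl

theorem norm_inclusion_limitOperator_le (ν : lipGames Ω) :
    ‖Submodule.inclusion NA_le_lipGames (limitOperator Ω ν)‖ ≤ ‖ν‖ := by
  refine le_of_forall_gt_imp_ge_of_dense fun r hr => ?_
  obtain ⟨μ, hμ, h, hlt⟩ := exists_dominated_lt ν hr
  exact (norm_le_of_dominated _ hμ (partitionLimit_dominated hμ h.abs_le)).trans hlt.le

theorem limitOperator_isContinuousMilnorExtension :
    IsContinuousMilnorExtension (limitOperator Ω) where
  milnor :=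
    { NA_le := NA_le_lipGames
      le_lipGames := le_rfl
      bounds := fun ν => by
        obtain ⟨lo, hlo⟩ := exists_isGreatest_lowerMeasures ν.2
        obtain ⟨hi, hhi⟩ := exists_isLeast_upperMeasures ν.2
        obtain ⟨μ, hμ, h⟩ := exists_abs_le ν
        exact ⟨lo, hi, hlo.isLUB, hhi.isGLB,
          le_partitionLimit_of_le hμ h lo.2 (Game.Prec.le hlo.1),
          partitionLimit_le hμ h hi.2 (Game.Prec.le hhi.1)⟩ }
  continuous := by
    let f : lipGames Ω →ₗ[ℝ] lipGames Ω :=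
      (Submodule.inclusion NA_le_lipGames).comp (limitOperator Ω)
    exact (f.mkContinuous 1 fun ν => by
      rw [one_mul]; exact norm_inclusion_limitOperator_le ν).continuous
  extends_BC := fun ν hν => by
    obtain ⟨m, hm⟩ := hν.1
    obtain ⟨μ, hμ, h⟩ := exists_abs_le ν
    rw [limitOperator_coe, partitionLimit_eq_of_isBCIntegral hμ h hm]
    exact hm

/-! ### Automorphisms -/

/-- The order isomorphism of the coalitions induced by an automorphism. -/
def imageIso {Ω : Type*} [MeasurableSpace Ω] (θ : Ω ≃ᵐ Ω) : Coalition Ω ≃o Coalition Ω where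
  toFun := imageCoalition θ
  invFun := imageCoalition θ.symm
  left_inv S := Subtype.ext (by simp [imageCoalition, Set.image_image])
  right_inv S := Subtype.ext (by simp [imageCoalition, Set.image_image])
  map_rel_iff' := Set.image_subset_image_iff θ.injective

theorem pullback_apply {Ω : Type*} [MeasurableSpace Ω] (θ : Ω ≃ᵐ Ω) (ν : Game Ω)
    (S : Coalition Ω) : pullback θ ν S = ν (imageIso θ S) := rfl

theorem pullback_mem_NA (θ : Ω ≃ᵐ Ω) {lam : Game Ω} (h : lam ∈ NA Ω) :
    pullback θ lam ∈ NA Ω := by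
  obtain ⟨⟨m, hm⟩, hna⟩ := h
  have hmeas : (pullback θ lam).IsMeasure := by
    refine ⟨m.map θ.symm, fun S => ?_⟩
    rw [VectorMeasure.map_apply _ θ.symm.measurable S.2, ← MeasurableEquiv.image_eq_preimage_symm]
    exact hm _
  refine ⟨hmeas, hmeas.isNonatomic fun x => ?_⟩
  have : imageIso θ (single x) = single (θ x) := Subtype.ext Set.image_singleton
  rw [pullback_apply, this, hna.single_eq_zero]

theorem pullback_mem_NAplus (θ : Ω ≃ᵐ Ω) {μ : Game Ω} (h : μ ∈ NAplus Ω) :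
    pullback θ μ ∈ NAplus Ω :=
  ⟨pullback_mem_NA θ h.1, fun S => h.2 (imageIso θ S)⟩

theorem Game.Dominated.pullback (θ : Ω ≃ᵐ Ω) {ν μ : Game Ω} (h : ν.Dominated μ) :
    (pullback θ ν).Dominated (pullback θ μ) := by
  rw [Game.dominated_iff] at *
  exact fun S T hST => h _ _ ((imageIso θ).monotone hST)

theorem pullback_mem_lipGames (θ : Ω ≃ᵐ Ω) {ν : Game Ω} (h : ν ∈ lipGames Ω) :
    pullback θ ν ∈ lipGames Ω := by
  obtain ⟨-, μ, hμ, h⟩ := h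
  have hμ' := pullback_mem_NAplus θ hμ
  exact ⟨isBV_of_dominated (h.pullback θ) (NAplus.monotone hμ'), _, hμ', h.pullback θ⟩

/-- The map `θ_*` on the Lipschitz games. -/
def lipPullback (θ : Ω ≃ᵐ Ω) : lipGames Ω →ₗ[ℝ] lipGames Ω :=
  (pullback θ).restrict fun _ => pullback_mem_lipGames θ

theorem norm_lipPullback_le (θ : Ω ≃ᵐ Ω) (ν : lipGames Ω) : ‖lipPullback θ ν‖ ≤ ‖ν‖ := by
  refine le_of_forall_gt_imp_ge_of_dense fun r hr => ?_
  obtain ⟨μ, hμ, h, hlt⟩ := exists_dominated_lt ν hr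
  refine (norm_le_of_dominated (lipPullback θ ν) (pullback_mem_NAplus θ hμ)
    (h.pullback θ)).trans ?_
  exact (NAplus.monotone hμ le_top).trans hlt.le

theorem continuous_lipPullback (θ : Ω ≃ᵐ Ω) : Continuous (lipPullback θ) :=
  ((lipPullback θ).mkContinuous 1 fun ν => by
    rw [one_mul]; exact norm_lipPullback_le θ ν).continuous

theorem continuous_apply_coalition (S : Coalition Ω) :
    Continuous fun ν : lipGames Ω => (ν : Game Ω) S := by
  let f : lipGames Ω →ₗ[ℝ] ℝ :=
    { toFun := fun ν => (ν : Game Ω) S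
      map_add' := fun _ _ => rfl
      map_smul' := fun _ _ => rfl }
  exact (f.mkContinuous 1 fun ν => by
    rw [one_mul]; exact abs_apply_le_norm ν S).continuous

/-- The automorphism carries partitions of `E` to partitions of its image, preserving sums and, with
`μ` pulled back as well, smallness of the mesh. -/
theorem IsBCIntegral.pullback (θ : Ω ≃ᵐ Ω) {ν : Game Ω} {m : Coalition Ω → ℝ}
    (h : IsBCIntegral ν m) : IsBCIntegral (pullback θ ν) (fun S => m (imageIso θ S)) := by
  obtain ⟨μ, hμ, h⟩ := h
  refine ⟨TUGame.pullback θ μ, pullback_mem_NAplus θ hμ, fun E ε hε => ?_⟩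
  obtain ⟨δ, hδ, hD⟩ := h (imageIso θ E) ε hε
  refine ⟨δ, hδ, fun D hm => ?_⟩
  rw [mesh_lt_iff _ _ hδ] at hm
  have h1 := hD (D.map (imageIso θ)) (by
    rw [mesh_lt_iff _ _ hδ, Finpartition.parts_map]
    intro I hI
    obtain ⟨J, hJ, rfl⟩ := Finset.mem_map.1 hI
    exact hm J hJ)
  rw [Finpartition.parts_map, Finset.sum_map] at h1
  exact h1

theorem pullback_mem_Q (θ : Ω ≃ᵐ Ω) {ν : Game Ω} (h : ν ∈ Q Ω) : pullback θ ν ∈ Q Ω := by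
  obtain ⟨⟨m, hm⟩, hlip⟩ := h
  exact ⟨⟨_, hm.pullback θ⟩, pullback_mem_lipGames θ hlip⟩

/-! ### The restriction to the closure of `Q` -/

theorem mem_Y_iff {ν : Game Ω} : ν ∈ Y Ω ↔ ∃ h : ν ∈ lipGames Ω,
    (⟨ν, h⟩ : lipGames Ω) ∈ closure {ν : lipGames Ω | (ν : Game Ω) ∈ Q Ω} := by
  constructor
  · rintro ⟨ν, hν, rfl⟩
    exact ⟨ν.2, hν⟩
  · rintro ⟨h, hν⟩
    exact ⟨⟨ν, h⟩, hν, rfl⟩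

theorem isBCIntegral_self {lam : Game Ω} (h : lam ∈ NA Ω) : IsBCIntegral lam lam :=
  -- All partition sums equal `lam E`, so the mesh measure and `δ` are arbitrary.
  ⟨0, NAplus.zero, fun E ε hε => ⟨1, one_pos, fun D _ => by
    rwa [NA.sum_parts h, sub_self, abs_zero]⟩⟩

theorem Q_le_Y : Q Ω ≤ Y Ω := fun _ h => mem_Y_iff.2 ⟨h.2, subset_closure h⟩

theorem NA_le_Y : NA Ω ≤ Y Ω := fun _ h =>
  Q_le_Y ⟨⟨_, isBCIntegral_self h⟩, NA_le_lipGames h⟩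

theorem isSymmetricSpace_Y : IsSymmetricSpace (Y Ω) := by
  intro θ ν hν
  obtain ⟨h, hcl⟩ := mem_Y_iff.1 hν
  refine mem_Y_iff.2 ⟨pullback_mem_lipGames θ h, ?_⟩
  exact map_mem_closure (continuous_lipPullback θ) hcl fun _ => pullback_mem_Q θ

theorem IsMilnorOperator.le_of_prec {V : Submodule ℝ (Game Ω)} {ψ : V →ₗ[ℝ] NA Ω}
    (h : IsMilnorOperator V ψ) {ν : V} {lam : NA Ω} (hlam : Game.Prec (ν : Game Ω) lam) : ψ ν ≤ lam := by
  obtain ⟨_, hi, -, hhi, -, hle⟩ := h.bounds ν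
  exact hle.trans (hhi.1 hlam)

theorem IsMilnorOperator.ge_of_prec {V : Submodule ℝ (Game Ω)} {ψ : V →ₗ[ℝ] NA Ω}
    (h : IsMilnorOperator V ψ) {ν : V} {lam : NA Ω} (hlam : Game.Prec (lam : Game Ω) ν) : lam ≤ ψ ν := by
  obtain ⟨lo, _, hlo, -, hle, -⟩ := h.bounds ν
  exact (hlo.1 hlam).trans hle

/-- For games in `Q` both sides are the Burkill-Cesari integral of the transported game, which is
unique. At a fixed coalition the equality is a closed condition, as evaluation, `ψ` and `θ_*` are
continuous. -/
theorem IsContinuousMilnorExtension.pullback_eq {ψ : lipGames Ω →ₗ[ℝ] NA Ω}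
    (hψ : IsContinuousMilnorExtension ψ) (θ : Ω ≃ᵐ Ω) {ν : lipGames Ω}
    (hν : (ν : Game Ω) ∈ Y Ω) :
    (ψ (lipPullback θ ν) : Game Ω) = pullback θ (ψ ν) := by
  obtain ⟨_, hcl⟩ := mem_Y_iff.1 hν
  refine Game.ext fun S => ?_
  have hc := fun S => (continuous_apply_coalition S).comp hψ.continuous
  refine closure_minimal (t := {ν : lipGames Ω |
      (ψ (lipPullback θ ν) : Game Ω) S = (ψ ν : Game Ω) (imageIso θ S)}) (fun ν' h' => ?_)
    (isClosed_eq ((hc S).comp (continuous_lipPullback θ)) (hc (imageIso θ S))) hcl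
  exact congrFun ((hψ.extends_BC (lipPullback θ ν') (pullback_mem_Q θ h')).unique
    ((hψ.extends_BC ν' h').pullback θ)) S

theorem IsContinuousMilnorExtension.isMilnorSemivalue {ψ : lipGames Ω →ₗ[ℝ] NA Ω}
    (hψ : IsContinuousMilnorExtension ψ) :
    IsMilnorSemivalue (Y Ω) (ψ ∘ₗ Submodule.inclusion Y_le_lipGames) := by
  have hmil : IsMilnorOperator (Y Ω) (ψ ∘ₗ Submodule.inclusion Y_le_lipGames) :=
    ⟨NA_le_Y, Y_le_lipGames, fun ν => hψ.milnor.bounds (Submodule.inclusion Y_le_lipGames ν)⟩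
  refine ⟨hmil, fun ν hν => (Y_le_lipGames hν).1, isSymmetricSpace_Y, fun θ ν => ?_,
    fun ν hν => ?_, fun ν hν => ?_⟩
  · exact hψ.pullback_eq θ (ν := Submodule.inclusion Y_le_lipGames ν) ν.2
  -- For monotone `ν` the zero measure lies in `lowerMeasures ν`.
  · refine hmil.ge_of_prec ?_
    rw [Game.Prec, ZeroMemClass.coe_zero, sub_zero]
    exact hν
  -- A measure belongs to both its own upper and lower sets, so the bounds pin `ψ ν` to `ν`.
  · have hrefl : Game.Prec (ν : Game Ω) ν := by
      rw [Game.Prec, sub_self]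
      exact monotone_const
    exact congrArg Subtype.val (le_antisymm (hmil.le_of_prec (lam := ⟨ν, hν⟩) hrefl)
      (hmil.ge_of_prec (lam := ⟨ν, hν⟩) hrefl))

end Nonatomic

end TUGame
end

theorem theorem4p1 {Ω : Type*} [MeasurableSpace Ω] [StandardBorelSpace Ω] :
    (∃ ψ : TUGame.lipGames Ω →ₗ[ℝ] TUGame.NA Ω, TUGame.IsContinuousMilnorExtension ψ) ∧
    ∀ ψ : TUGame.lipGames Ω →ₗ[ℝ] TUGame.NA Ω, TUGame.IsContinuousMilnorExtension ψ →
      TUGame.IsMilnorSemivalue (TUGame.Y Ω)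
        (ψ ∘ₗ Submodule.inclusion TUGame.Y_le_lipGames) :=
  ⟨⟨_, TUGame.limitOperator_isContinuousMilnorExtension⟩, fun _ hψ => hψ.isMilnorSemivalue⟩
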